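/- Let $(F,g_F)$ be a connected Riemannian manifold of dimension $n-1\ge 2$, let $I\subseteq\mathbb{R}$ be an open interval and let $f:I\to(0,\infty)$ be smooth. Let $\overline M=I\times_f F$ be the associated GRW spacetime, i.e. the manifold $I\times F$ with the Lorentzian metric $\overline g=-\pi_I^*(dt^2)+f(\pi_I)^2\,\pi_F^*(g_F)$, and let $\partial_t=\partial/\partial t$. Let $M^k$ be a connected smooth manifold and $\psi:M\to\overline M$ a smooth spacelike immersion, i.e. the induced metric $g=\psi^*\overline g$ is Riemannian. Put $\tau=\pi_I\circ\psi$. Let $\mathrm{II}(X,Y)=-(\overline\nabla_XY)^\perp$ be the second fundamental form of $\psi$ (note the sign), where $\overline\nabla$ is the Levi-Civita connection of $\overline g$ and $\perp$ denotes the normal component, and let $\overrightarrow{H}=\frac1k\,\mathrm{trace}_g(\mathrm{II})$ be the mean curvature vector field. Assume that $(M,g)$ is parabolic, i.e. every smooth function $u$ on $M$ that is bounded from below and superharmonic ($\Delta u\le 0$ for the Laplacian $\Delta$ of $g$) is constant, and that $\psi(M)$ is contained in a slab, i.e. there are $c,d\in I$ with $c\le\tau\le d$ on $M$. If $$\overline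 g(\overrightarrow H,\partial_t)\le\frac{f'(\tau)}{f(\tau)}\ \text{ everywhere on } M,\qquad\text{or}\qquad \overline g(\overrightarrow H,\partial_t)\ge\frac{f'(\tau)}{f(\tau)}\ \text{ everywhere on } M,$$ then $\psi(M)$ is contained in a spacelike slice $\{t_0\}\times F$ for some $t_0\in I$. -/

import Mathlib

open Set Bundle
open scoped Manifold ContDiff

noncomputable section

namespace GRW

/-! ### Metric tensors, Levi-Civita connection, Hessian and Laplacian

Mathlib identifies the tangent space `TangentSpace J x` with the model space `E` through the
preferred chart at `x`. -/

/-- The pull-back `(v, w) ↦ b(A v, A w)` of a bilinear form `b`. -/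
def pullback {E E' : Type*} [NormedAddCommGroup E] [NormedSpace ℝ E] [NormedAddCommGroup E']
    [NormedSpace ℝ E'] (A : E →L[ℝ] E') (b : E' →L[ℝ] E' →L[ℝ] ℝ) : E →L[ℝ] E →L[ℝ] ℝ :=
  b.bilinearComp A A

section General

variable {E H N : Type*} [NormedAddCommGroup E] [NormedSpace ℝ E] [TopologicalSpace H]
  (J : ModelWithCorners ℝ E H) [TopologicalSpace N] [ChartedSpace H N]

/-- A field of bilinear forms on the tangent spaces of `N`. -/
abbrev MetricTensor : Type _ :=
  ∀ x : N, TangentSpace J x →L[ℝ] TangentSpace J x →L[ℝ] ℝ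

variable {J}

/-- The bilinear form `g x` on the tangent space at `x`, read on the model space. -/
def formAt (g : MetricTensor J (N := N)) (x : N) : E →L[ℝ] E →L[ℝ] ℝ := g x

/-- The components of the metric tensor `g` in the chart at `x₀`:
`G(y)(v, w) = g(Dφ⁻¹(y) v, Dφ⁻¹(y) w)`, where `φ` is the chart at `x₀`. -/
def coordMetric (g : MetricTensor J (N := N)) (x₀ : N) (y : E) : E →L[ℝ] E →L[ℝ] ℝ :=
  pullback (E := E) (E' := E) (mfderivWithin 𝓘(ℝ, E) J (extChartAt J x₀).symm (range J) y)
    (formAt g ((extChartAt J x₀).symm y))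

/-- The vector `♯α` with `b(♯α, ·) = α`, for a nondegenerate bilinear form `b` on a
finite-dimensional space (`b` is read as the linear map `v ↦ b(v, ·)`, and inverted). -/
def sharp (b : E →L[ℝ] E →L[ℝ] ℝ) (α : E →L[ℝ] ℝ) : E :=
  ContinuousLinearMap.inverse b α

/-- Christoffel symbols of the metric with components `G`: `Γ(u, v)` is the vector with
`G(Γ(u, v), w) = ½ (∂_u G(v, w) + ∂_v G(u, w) - ∂_w G(u, v))` for all `w`. -/
def christoffel (G : E → E →L[ℝ] E →L[ℝ] ℝ) (y : E) (u v : E) : E :=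
  sharp (G y) ((1 / 2 : ℝ) •
    (fderiv ℝ G y u v + fderiv ℝ G y v u - ((fderiv ℝ G y).flip u).flip v))

/-- Christoffel symbols, at the point `x` and in the chart at `x`, of the Levi-Civita connection
of `g`. -/
def christoffelAt (g : MetricTensor J (N := N)) (x : N) (u v : E) : E :=
  christoffel (coordMetric g x) (extChartAt J x x) u v

end General

section Submanifold

variable {k : ℕ} {M : Type*} [TopologicalSpace M] [ChartedSpace (EuclideanSpace ℝ (Fin k)) M]

/-- The trace with respect to `b` of a bilinear map `S`: `∑ b^{ij} S(e_i, e_j)`. When `b` is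
positive definite this is `∑ S(E_i, E_i)` for any `b`-orthonormal basis `(E_i)`. -/
def metricTrace {W : Type*} [AddCommGroup W]
    (b : EuclideanSpace ℝ (Fin k) →L[ℝ] EuclideanSpace ℝ (Fin k) →L[ℝ] ℝ)
    (S : EuclideanSpace ℝ (Fin k) → EuclideanSpace ℝ (Fin k) → W) : W :=
  ∑ i, S (EuclideanSpace.single i 1) (sharp b (EuclideanSpace.proj i))

/-- The Hessian `Hess u (v, w) = ∂_v ∂_w u - du(Γ(v, w))` at `p`, in the chart at `p`. -/
def hessian (g : MetricTensor (𝓡 k) (N := M)) (u : M → ℝ) (p : M)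
    (v w : EuclideanSpace ℝ (Fin k)) : ℝ :=
  fderiv ℝ (fderiv ℝ (u ∘ (extChartAt (𝓡 k) p).symm)) (extChartAt (𝓡 k) p p) v w
    - fderiv ℝ (u ∘ (extChartAt (𝓡 k) p).symm) (extChartAt (𝓡 k) p p) (christoffelAt g p v w)

/-- The Laplace-Beltrami operator `Δ u = trace_g (Hess u)`. -/
def laplacian (g : MetricTensor (𝓡 k) (N := M)) (u : M → ℝ) (p : M) : ℝ :=
  metricTrace (formAt g p) (hessian g u p)

/-- `(M, g)` is parabolic: the only (smooth) superharmonic functions on `M` that are bounded from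
below are the constants. -/
def IsParabolic (g : MetricTensor (𝓡 k) (N := M)) : Prop :=
  ∀ u : M → ℝ, ContMDiff (𝓡 k) 𝓘(ℝ, ℝ) ∞ u → (∀ p, laplacian g u p ≤ 0) →
    BddBelow (range u) → ∃ c : ℝ, ∀ p, u p = c

variable {E H N : Type*} [NormedAddCommGroup E] [NormedSpace ℝ E] [TopologicalSpace H]
  {J : ModelWithCorners ℝ E H} [TopologicalSpace N] [ChartedSpace H N]

variable (k)

/-- The differential of `ψ` at `p`, read on the model spaces. -/
def diff (J : ModelWithCorners ℝ E H) (ψ : M → N) (p : M) : EuclideanSpace ℝ (Fin k) →L[ℝ] E :=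
  mfderiv (𝓡 k) J ψ p

/-- The metric `ψ^* g` induced on `M` by `ψ : M → (N, g)`. -/
def inducedMetric (g : MetricTensor J (N := N)) (ψ : M → N) : MetricTensor (𝓡 k) (N := M) :=
  fun p => pullback (diff k J ψ p) (formAt g (ψ p))

/-- `ψ` is spacelike: the induced metric is positive definite. In particular `dψ` is injective. -/
def IsSpacelike (g : MetricTensor J (N := N)) (ψ : M → N) : Prop :=
  ∀ (p : M) (v : TangentSpace (𝓡 k) p), v ≠ 0 →
    0 < g (ψ p) (mfderiv (𝓡 k) J ψ p v) (mfderiv (𝓡 k) J ψ p v)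

/-- `∇̄_u V` at `p`, for the Levi-Civita connection `∇̄` of `g`, where `V` is the tangent field
`dψ(v)` and `v` is extended to a vector field near `p` with constant components in the chart at
`p`. In the charts at `p` and `ψ p` it is `∂_u ∂_v ψ + Γ̄(∂_u ψ, ∂_v ψ)`. -/
def ambientDeriv (g : MetricTensor J (N := N)) (ψ : M → N) (p : M)
    (u v : EuclideanSpace ℝ (Fin k)) : E :=
  fderiv ℝ (fderiv ℝ (writtenInExtChartAt (𝓡 k) J p ψ)) (extChartAt (𝓡 k) p p) u v
    + christoffelAt g (ψ p) (diff k J ψ p u) (diff k J ψ p v)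

/-- The component of `w` tangent to `ψ` at `p`: it is `dψ(a)`, where `a` is determined by
`(ψ^* g)(a, ·) = g(w, dψ(·))`. -/
def tangentPart (g : MetricTensor J (N := N)) (ψ : M → N) (p : M) (w : E) : E :=
  diff k J ψ p (sharp (formAt (inducedMetric k g ψ) p) ((formAt g (ψ p) w).comp (diff k J ψ p)))

/-- The component of `w` normal to `ψ` at `p`. -/
def normalPart (g : MetricTensor J (N := N)) (ψ : M → N) (p : M) (w : E) : E :=
  w - tangentPart k g ψ p w

/-- The second fundamental form, with the sign convention `II(u, v) = -(∇̄_u v)^⊥`. -/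
def secondFundamentalForm (g : MetricTensor J (N := N)) (ψ : M → N) (p : M)
    (u v : EuclideanSpace ℝ (Fin k)) : E :=
  -normalPart k g ψ p (ambientDeriv k g ψ p u v)

/-- The mean curvature vector `H = (1 / k) trace(II)`. -/
def meanCurvature (g : MetricTensor J (N := N)) (ψ : M → N) (p : M) : TangentSpace J (ψ p) :=
  ((1 / k : ℝ) •
    metricTrace (formAt (inducedMetric k g ψ) p) (secondFundamentalForm k g ψ p) : E)

end Submanifold

/-! ### Generalized Robertson-Walker spacetimes

For an open interval `I`, the manifold `I × F` is handled as the open subset `I ×ˢ univ` of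
`ℝ × F`. -/

section Spacetime

variable {m : ℕ} {F : Type*} [TopologicalSpace F] [ChartedSpace (EuclideanSpace ℝ (Fin m)) F]
  [IsManifold (𝓡 m) ∞ F]

/-- Smooth Riemannian metrics on `F`. -/
abbrev RiemMetric (m : ℕ) (F : Type*) [TopologicalSpace F]
    [ChartedSpace (EuclideanSpace ℝ (Fin m)) F] [IsManifold (𝓡 m) ∞ F] : Type _ :=
  ContMDiffRiemannianMetric (𝓡 m) ∞ (EuclideanSpace ℝ (Fin m))
    (fun x : F => TangentSpace (𝓡 m) x)

/-- The Lorentzian metric `-π_I^* dt² + f(π_I)² π_F^* g_F`. -/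
def warpedMetric (f : ℝ → ℝ) (gF : RiemMetric m F) :
    MetricTensor (𝓘(ℝ, ℝ).prod (𝓡 m)) (N := ℝ × F) := fun q =>
  -pullback (E := ℝ × EuclideanSpace ℝ (Fin m)) (E' := ℝ)
      (mfderiv (𝓘(ℝ, ℝ).prod (𝓡 m)) 𝓘(ℝ, ℝ) Prod.fst q) (ContinuousLinearMap.mul ℝ ℝ)
    + (f q.1 ^ 2) • pullback (E := ℝ × EuclideanSpace ℝ (Fin m)) (E' := EuclideanSpace ℝ (Fin m))
      (mfderiv (𝓘(ℝ, ℝ).prod (𝓡 m)) (𝓡 m) Prod.snd q) (gF.inner q.2)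

/-- The vector field `∂_t`. -/
def partialT (q : ℝ × F) : TangentSpace (𝓘(ℝ, ℝ).prod (𝓡 m)) q :=
  ((1 : ℝ), (0 : EuclideanSpace ℝ (Fin m)))

/-- The spacelike slice `{t₀} × F`. -/
def slice (F : Type*) (t₀ : ℝ) : Set (ℝ × F) := {t₀} ×ˢ univ

/-- `S` lies in a slab of `I × F`, i.e. between two spacelike slices `{c} × F` and `{d} × F` with
`c, d ∈ I`. -/
def InSlab (I : Set ℝ) (S : Set (ℝ × F)) : Prop :=
  ∃ c ∈ I, ∃ d ∈ I, S ⊆ Icc c d ×ˢ univ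

end Spacetime

end GRW

end

/-! Let `Φ` be a primitive of `f`. The gradient of `Φ ∘ π_I` is the closed conformal field `-f ∂_t`,
so `Hess (Φ ∘ π_I) = -f' ḡ`. Along the immersion, the Gauss formula turns this into
`Δ(Φ ∘ τ) = k f(τ) (ḡ(H, ∂_t) - f'(τ) / f(τ))`, which has a sign by the mean curvature bound. The
slab bounds `Φ ∘ τ` on the side that parabolicity requires, so `Φ ∘ τ` is constant, and `τ` is
constant because `Φ` is strictly increasing. -/

namespace GRW

open Filter Topology

section Linear

variable {E E' X : Type*} [NormedAddCommGroup E] [NormedSpace ℝ E] [NormedAddCommGroup E']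
  [NormedSpace ℝ E'] [NormedAddCommGroup X] [NormedSpace ℝ X]

lemma isInvertible_of_separatingLeft [FiniteDimensional ℝ E] (b : E →L[ℝ] E →L[ℝ] ℝ)
    (hb : ∀ v, (∀ w, b v w = 0) → v = 0) : b.IsInvertible := by
  have hinj : Function.Injective (b : E →ₗ[ℝ] E →L[ℝ] ℝ) :=
    (injective_iff_map_eq_zero _).2 fun v hv => hb v fun w => congrArg (fun α => α w) hv
  have hrank : Module.finrank ℝ E = Module.finrank ℝ (E →L[ℝ] ℝ) := by
    rw [(LinearMap.toContinuousLinearMap (𝕜 := ℝ) (E := E) (F' := ℝ)).symm.finrank_eq]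
    exact Subspace.dual_finrank_eq.symm
  exact ⟨(LinearEquiv.ofInjectiveOfFinrankEq _ hinj hrank).toContinuousLinearEquiv, rfl⟩

lemma apply_sharp {b : E →L[ℝ] E →L[ℝ] ℝ} (hb : b.IsInvertible) (α : E →L[ℝ] ℝ) :
    b (sharp b α) = α :=
  hb.self_apply_inverse α

lemma differentiableAt_pullback {A : X → E →L[ℝ] E'} {b : X → E' →L[ℝ] E' →L[ℝ] ℝ} {x : X}
    (hA : DifferentiableAt ℝ A x) (hb : DifferentiableAt ℝ b x) :
    DifferentiableAt ℝ (fun y => pullback (A y) (b y)) x := by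
  have hprecomp : DifferentiableAt ℝ (fun y => (ContinuousLinearMap.compL ℝ E E' ℝ).flip (A y)) x :=
    DifferentiableAt.comp (G := (E' →L[ℝ] ℝ) →L[ℝ] E →L[ℝ] ℝ) x
      (ContinuousLinearMap.differentiableAt _) hA
  exact hprecomp.clm_comp (hb.clm_comp hA)

lemma fderiv_apply_apply {b : X → E →L[ℝ] E' →L[ℝ] ℝ} {x : X} (hb : DifferentiableAt ℝ b x)
    (u : X) (v : E) (w : E') : fderiv ℝ b x u v w = fderiv ℝ (fun y => b y v w) x u := by
  rw [fderiv_clm_apply (hb.clm_apply (differentiableAt_const v)) (differentiableAt_const w),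
    fderiv_clm_apply hb (differentiableAt_const v)]
  simp

lemma fderiv_pullback_apply {A : X → E →L[ℝ] E'} {b : X → E' →L[ℝ] E' →L[ℝ] ℝ} {x : X}
    (hA : DifferentiableAt ℝ A x) (hb : DifferentiableAt ℝ b x) (u : X) (v w : E) :
    fderiv ℝ (fun y => pullback (A y) (b y)) x u v w =
      fderiv ℝ b x u (A x v) (A x w) + b x (fderiv ℝ A x u v) (A x w)
        + b x (A x v) (fderiv ℝ A x u w) := by
  have hAv (v : E) : DifferentiableAt ℝ (fun y => A y v) x :=
    hA.clm_apply (differentiableAt_const v)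
  rw [fderiv_apply_apply (differentiableAt_pullback hA hb)]
  change fderiv ℝ (fun y => b y (A y v) (A y w)) x u = _
  rw [fderiv_clm_apply (hb.clm_apply (hAv v)) (hAv w), fderiv_clm_apply hb (hAv v),
    fderiv_clm_apply hA (differentiableAt_const v), fderiv_clm_apply hA (differentiableAt_const w)]
  simp
  ring

lemma fderiv_fderiv_comp {W : Type*} [NormedAddCommGroup W] [NormedSpace ℝ W] {φ : E' → W}
    {P : E → E'} {y : E} (hφ : ContDiffAt ℝ 2 φ (P y)) (hP : ContDiffAt ℝ 2 P y) (u v : E) :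
    fderiv ℝ (fderiv ℝ (φ ∘ P)) y u v =
      fderiv ℝ (fderiv ℝ φ) (P y) (fderiv ℝ P y u) (fderiv ℝ P y v)
        + fderiv ℝ φ (P y) (fderiv ℝ (fderiv ℝ P) y u v) := by
  have hchain : fderiv ℝ (φ ∘ P) =ᶠ[𝓝 y] fun z => (fderiv ℝ φ (P z)).comp (fderiv ℝ P z) := by
    filter_upwards [hP.continuousAt.eventually (hφ.eventually (by simp)), hP.eventually (by simp)]
      with z hφz hPz
    exact fderiv_comp z (hφz.differentiableAt (by simp)) (hPz.differentiableAt (by simp))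
  have hdφ : DifferentiableAt ℝ (fderiv ℝ φ) (P y) :=
    (hφ.fderiv_right (m := 1) (by norm_num)).differentiableAt (by simp)
  have hdP : DifferentiableAt ℝ (fderiv ℝ P) y :=
    (hP.fderiv_right (m := 1) (by norm_num)).differentiableAt (by simp)
  have hP1 : DifferentiableAt ℝ P y := hP.differentiableAt (by simp)
  have hφP : DifferentiableAt ℝ (fun z => fderiv ℝ φ (P z)) y := hdφ.comp y hP1
  rw [hchain.fderiv_eq, fderiv_clm_comp hφP hdP]
  simp [fderiv_fun_comp y hdφ hP1, add_comm]

/-- The Christoffel symbols of the first kind `Γ(u, v, w)` of the metric with components `G`;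
`christoffel` raises the index `w`. -/
noncomputable def christoffelFirstKind (G : E → E →L[ℝ] E →L[ℝ] ℝ) (y u v : E) : E →L[ℝ] ℝ :=
  (1 / 2 : ℝ) • (fderiv ℝ G y u v + fderiv ℝ G y v u - ((fderiv ℝ G y).flip u).flip v)

lemma christoffelFirstKind_apply (G : E → E →L[ℝ] E →L[ℝ] ℝ) (y u v w : E) :
    christoffelFirstKind G y u v w =
      1 / 2 * (fderiv ℝ G y u v w + fderiv ℝ G y v u w - fderiv ℝ G y w u v) := by
  simp [christoffelFirstKind]

lemma apply_christoffel {G : E → E →L[ℝ] E →L[ℝ] ℝ} {y : E} (hG : (G y).IsInvertible) (u v : E) :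
    G y (christoffel G y u v) = christoffelFirstKind G y u v :=
  apply_sharp hG _

set_option synthInstance.maxHeartbeats 100000 in
-- the group structure on bilinear maps is expensive to synthesize
lemma christoffelFirstKind_pullback {P : E → E'} {y : E} (hP : ContDiffAt ℝ 2 P y)
    {G : E' → E' →L[ℝ] E' →L[ℝ] ℝ} (hG : DifferentiableAt ℝ G (P y))
    (hsymm : ∀ v w, G (P y) v w = G (P y) w v) (hinv : (G (P y)).IsInvertible) (u v w : E) :
    christoffelFirstKind (fun z => pullback (fderiv ℝ P z) (G (P z))) y u v w =
      G (P y) (fderiv ℝ (fderiv ℝ P) y u v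
        + christoffel G (P y) (fderiv ℝ P y u) (fderiv ℝ P y v)) (fderiv ℝ P y w) := by
  have hP1 : DifferentiableAt ℝ P y := hP.differentiableAt (by simp)
  have hP2 : DifferentiableAt ℝ (fderiv ℝ P) y :=
    (hP.fderiv_right (m := 1) (by norm_num)).differentiableAt (by simp)
  have hsnd (a b : E) : fderiv ℝ (fderiv ℝ P) y a b = fderiv ℝ (fderiv ℝ P) y b a :=
    hP.isSymmSndFDerivAt (by simp) a b
  have hGP : HasFDerivAt (fun z => G (P z)) (fderiv ℝ G (P y) ∘L fderiv ℝ P y) y :=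
    hG.hasFDerivAt.comp (G := E' →L[ℝ] E' →L[ℝ] ℝ) y hP1.hasFDerivAt
  simp only [christoffelFirstKind_apply, fderiv_pullback_apply hP2 hGP.differentiableAt, hGP.fderiv,
    map_add, add_apply, apply_christoffel hinv, ContinuousLinearMap.comp_apply]
  rw [hsnd v u, hsnd w u, hsnd w v, hsymm (fderiv ℝ P y v), hsymm (fderiv ℝ P y u)]
  ring

end Linear

section Charts

variable {E H N : Type*} [NormedAddCommGroup E] [NormedSpace ℝ E] [TopologicalSpace H]
  {J : ModelWithCorners ℝ E H} [TopologicalSpace N] [ChartedSpace H N]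

lemma coordMetric_self [IsManifold J 1 N] (g : MetricTensor J (N := N)) (x : N) :
    coordMetric g x (extChartAt J x x) = formAt g x := by
  rw [coordMetric, mfderivWithin_range_extChartAt_symm, extChartAt_to_inv]
  rfl

lemma coordMetric_eq_inCoordinates [J.Boundaryless] [IsManifold J 1 N]
    (g : MetricTensor J (N := N)) (x₀ : N) {y : E} (hy : y ∈ (extChartAt J x₀).target) :
    coordMetric g x₀ y = ContinuousLinearMap.inCoordinates E (TangentSpace J) (E →L[ℝ] ℝ)
      (fun x : N => TangentSpace J x →L[ℝ] ℝ) x₀ ((extChartAt J x₀).symm y) x₀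
        ((extChartAt J x₀).symm y) (g ((extChartAt J x₀).symm y)) := by
  have hx : (extChartAt J x₀).symm y ∈ (chartAt H x₀).source := by
    rw [← extChartAt_source J x₀]
    exact (extChartAt J x₀).map_target hy
  have ht := TangentBundle.symmL_trivializationAt (I := J) hx
  rw [(extChartAt J x₀).right_inv hy] at ht
  ext v w
  refine Eq.trans ?_ (inCoordinates_apply_eq₂ (E₁ := TangentSpace J) (E₂ := TangentSpace J)
    (E₃ := Bundle.Trivial N ℝ) (by simpa using hx) (by simpa using hx) (mem_univ _)).symm
  rw [coordMetric, ← ht]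
  refine Eq.trans ?_ (congrFun (Trivialization.coe_linearMapAt_of_mem (R := ℝ)
    (trivializationAt ℝ (Bundle.Trivial N ℝ) x₀) (mem_univ _)) _).symm
  have hv (v : E) := Trivialization.symmL_apply (R := ℝ)
    (trivializationAt E (TangentSpace J) x₀) (by simpa using hx) v
  exact congrArg₂ (fun a b : E => formAt g ((extChartAt J x₀).symm y) a b) (hv v) (hv w)

lemma differentiableAt_coordMetric [J.Boundaryless] {n : ℕ∞ω} (hn : n ≠ 0) [IsManifold J 1 N]
    [IsManifold J n N] (g : ContMDiffRiemannianMetric J n E (fun x : N => TangentSpace J x))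
    (x : N) : DifferentiableAt ℝ (coordMetric g.inner x) (extChartAt J x x) := by
  have hsymm : ContMDiffAt 𝓘(ℝ, E) J n (extChartAt J x).symm (extChartAt J x x) :=
    (contMDiffOn_extChartAt_symm x).contMDiffAt (extChartAt_target_mem_nhds x)
  have hinner := ((contMDiffAt_hom_bundle _).1 (g.contMDiff x)).2.comp_of_eq hsymm
    (extChartAt_to_inv x)
  refine (hinner.contDiffAt.differentiableAt hn).congr_of_eventuallyEq ?_
  filter_upwards [extChartAt_target_mem_nhds (I := J) x] with y hy
  exact coordMetric_eq_inCoordinates g.inner x hy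

lemma hasMFDerivAt_extChartAt_symm [J.Boundaryless] [IsManifold J 1 N] (x : N) {y : E}
    (hy : y ∈ (extChartAt J x).target) :
    HasMFDerivAt 𝓘(ℝ, E) J (extChartAt J x).symm y
      (mfderivWithin 𝓘(ℝ, E) J (extChartAt J x).symm (range J) y) := by
  have h := mdifferentiableWithinAt_extChartAt_symm hy
  rw [J.range_eq_univ, mdifferentiableWithinAt_univ] at h
  rw [J.range_eq_univ, mfderivWithin_univ]
  exact h.hasMFDerivAt

end Charts

section Maps

variable {E H N E' H' N' : Type*} [NormedAddCommGroup E] [NormedSpace ℝ E] [TopologicalSpace H]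
  {J : ModelWithCorners ℝ E H} [TopologicalSpace N] [ChartedSpace H N]
  [NormedAddCommGroup E'] [NormedSpace ℝ E'] [TopologicalSpace H'] {J' : ModelWithCorners ℝ E' H'}
  [TopologicalSpace N'] [ChartedSpace H' N'] {ψ : N → N'} {p : N}

lemma eventually_map_extChartAt_symm_mem_source (hψ : ContinuousAt ψ p) :
    ∀ᶠ y in 𝓝 (extChartAt J p p),
      ψ ((extChartAt J p).symm y) ∈ (extChartAt J' (ψ p)).source := by
  refine (hψ.comp_of_eq (continuousAt_extChartAt_symm p) (extChartAt_to_inv p)).preimage_mem_nhds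
    (extChartAt_source_mem_nhds' ?_)
  simp

lemma comp_extChartAt_symm_eventuallyEq (hψ : ContinuousAt ψ p) :
    ψ ∘ (extChartAt J p).symm =ᶠ[𝓝 (extChartAt J p p)]
      (extChartAt J' (ψ p)).symm ∘ writtenInExtChartAt J J' p ψ := by
  filter_upwards [eventually_map_extChartAt_symm_mem_source (J' := J') hψ] with y hy
  exact ((extChartAt J' (ψ p)).left_inv hy).symm

lemma writtenInExtChartAt_extChartAt_self :
    writtenInExtChartAt J J' p ψ (extChartAt J p p) = extChartAt J' (ψ p) (ψ p) := by
  simp [writtenInExtChartAt]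

variable [J.Boundaryless]

lemma contDiffAt_writtenInExtChartAt {n : ℕ∞ω} (hψ : ContMDiffAt J J' n ψ p) :
    ContDiffAt ℝ n (writtenInExtChartAt J J' p ψ) (extChartAt J p p) := by
  have h := (contMDiffAt_iff.1 hψ).2
  rwa [J.range_eq_univ, contDiffWithinAt_univ] at h

lemma mfderiv_eq_fderiv_writtenInExtChartAt (hψ : MDifferentiableAt J J' ψ p) :
    mfderiv J J' ψ p = fderiv ℝ (writtenInExtChartAt J J' p ψ) (extChartAt J p p) := by
  rw [hψ.mfderiv, J.range_eq_univ, fderivWithin_univ]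

lemma mfderiv_mfderivWithin_extChartAt_symm [J'.Boundaryless] [IsManifold J 1 N]
    [IsManifold J' 1 N'] (hψ : MDifferentiable J J' ψ) (p : N) :
    ∀ᶠ y in 𝓝 (extChartAt J p p), ∀ v : E,
      mfderiv J J' ψ ((extChartAt J p).symm y)
          (mfderivWithin 𝓘(ℝ, E) J (extChartAt J p).symm (range J) y v) =
        mfderivWithin 𝓘(ℝ, E') J' (extChartAt J' (ψ p)).symm (range J')
          (writtenInExtChartAt J J' p ψ y) (fderiv ℝ (writtenInExtChartAt J J' p ψ) y v) := by
  have hψp : ContinuousAt ψ p := (hψ p).continuousAt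
  filter_upwards [eventually_map_extChartAt_symm_mem_source (J' := J') hψp,
    (comp_extChartAt_symm_eventuallyEq (J := J) (J' := J') hψp).eventuallyEq_nhds,
    extChartAt_target_mem_nhds (I := J) p] with y hsrc hcomp hy v
  have hleft := (hψ _).hasMFDerivAt.comp y (hasMFDerivAt_extChartAt_symm p hy)
  have hwritten : MDifferentiableAt 𝓘(ℝ, E) 𝓘(ℝ, E') (writtenInExtChartAt J J' p ψ) y :=
    MDifferentiableAt.comp (I' := J') y
      (mdifferentiableAt_extChartAt (by rwa [← extChartAt_source J'])) hleft.mdifferentiableAt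
  have hright := (hasMFDerivAt_extChartAt_symm (J := J') (ψ p)
    ((extChartAt J' (ψ p)).map_source hsrc)).comp y
      (mdifferentiableAt_iff_differentiableAt.1 hwritten).hasFDerivAt.hasMFDerivAt
  exact congrArg (fun L => L v) (hasMFDerivAt_unique hleft (hright.congr_of_eventuallyEq hcomp))

end Maps

section Submanifold

variable {k : ℕ} {M : Type*} [TopologicalSpace M] [ChartedSpace (EuclideanSpace ℝ (Fin k)) M]
variable {E H N : Type*} [NormedAddCommGroup E] [NormedSpace ℝ E] [TopologicalSpace H]
  {J : ModelWithCorners ℝ E H} [TopologicalSpace N] [ChartedSpace H N]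

lemma coordMetric_inducedMetric [IsManifold (𝓡 k) 1 M] [J.Boundaryless] [IsManifold J 1 N]
    (g : MetricTensor J (N := N)) {ψ : M → N} (hψ : MDifferentiable (𝓡 k) J ψ) (p : M) :
    coordMetric (inducedMetric k g ψ) p =ᶠ[𝓝 (extChartAt (𝓡 k) p p)]
      fun y => pullback (fderiv ℝ (writtenInExtChartAt (𝓡 k) J p ψ) y)
        (coordMetric g (ψ p) (writtenInExtChartAt (𝓡 k) J p ψ y)) := by
  filter_upwards [mfderiv_mfderivWithin_extChartAt_symm hψ p,
    comp_extChartAt_symm_eventuallyEq (J := 𝓡 k) (J' := J) (hψ p).continuousAt] with y hy hpt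
  ext v w
  change formAt g (ψ ((extChartAt (𝓡 k) p).symm y)) _ _ = formAt g ((extChartAt J (ψ p)).symm
    (writtenInExtChartAt (𝓡 k) J p ψ y)) _ _
  rw [← Function.comp_apply (f := (extChartAt J (ψ p)).symm), ← hpt]
  exact congrArg₂ (fun a b : E => formAt g (ψ ((extChartAt (𝓡 k) p).symm y)) a b) (hy v) (hy w)

end Submanifold

section SemiRiemannian

variable {E H N : Type*} [NormedAddCommGroup E] [NormedSpace ℝ E] [TopologicalSpace H]
  {J : ModelWithCorners ℝ E H} [TopologicalSpace N] [ChartedSpace H N]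

/-- The conditions at the single point `x` under which the Levi-Civita connection of `g` at `x` is
given by `christoffelAt g x`: the form `g x` is symmetric and nondegenerate, and the components of
`g` in the chart at `x` are differentiable there. -/
structure IsSemiRiemannianAt (g : MetricTensor J (N := N)) (x : N) : Prop where
  symm : ∀ v w, formAt g x v w = formAt g x w v
  isInvertible : (formAt g x).IsInvertible
  differentiableAt : DifferentiableAt ℝ (coordMetric g x) (extChartAt J x x)

/-- The differential of the function `h` at `x`, read on the model space. -/
noncomputable def differential (J : ModelWithCorners ℝ E H) (h : N → ℝ) (x : N) : E →L[ℝ] ℝ :=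
  mfderiv J 𝓘(ℝ, ℝ) h x

/-- The Hessian `Hess h (v, w) = ∂_v ∂_w h - dh(Γ(v, w))` at `x`, in the chart at `x`, on a manifold
with an arbitrary model; `hessian` is the case of the model `𝓡 k`. -/
noncomputable def hessianAt (g : MetricTensor J (N := N)) (h : N → ℝ) (x : N) (v w : E) : ℝ :=
  fderiv ℝ (fderiv ℝ (h ∘ (extChartAt J x).symm)) (extChartAt J x x) v w
    - fderiv ℝ (h ∘ (extChartAt J x).symm) (extChartAt J x x) (christoffelAt g x v w)

variable {k : ℕ} {M : Type*} [TopologicalSpace M] [ChartedSpace (EuclideanSpace ℝ (Fin k)) M]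

lemma natCast_mul_apply_meanCurvature (g : MetricTensor J (N := N)) (ψ : M → N) (p : M)
    (α : E →L[ℝ] ℝ) :
    k * α (meanCurvature k g ψ p) = metricTrace (formAt (inducedMetric k g ψ) p)
      (fun v w => α (secondFundamentalForm k g ψ p v w)) := by
  have hα : α (meanCurvature k g ψ p) = (1 / k : ℝ) * metricTrace (formAt (inducedMetric k g ψ) p)
      (fun v w => α (secondFundamentalForm k g ψ p v w)) :=
    (map_smul α _ _).trans (congrArg _ (map_sum α _ _))
  rcases eq_or_ne k 0 with rfl | hk
  · simp [metricTrace]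
  · rw [hα, ← mul_assoc, mul_one_div_cancel (Nat.cast_ne_zero.2 hk), one_mul]

lemma metricTrace_self {b : EuclideanSpace ℝ (Fin k) →L[ℝ] EuclideanSpace ℝ (Fin k) →L[ℝ] ℝ}
    (hsymm : ∀ v w, b v w = b w v) (hinv : b.IsInvertible) :
    metricTrace b (fun v w => b v w) = k := by
  simp [metricTrace, hsymm _ (sharp b _), apply_sharp hinv]

lemma IsSpacelike.isInvertible_inducedMetric {g : MetricTensor J (N := N)} {ψ : M → N}
    (hspace : IsSpacelike k g ψ) (p : M) : (formAt (inducedMetric k g ψ) p).IsInvertible :=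
  isInvertible_of_separatingLeft _ fun v hv => by_contra fun hne => (hspace p v hne).ne' (hv v)

variable [IsManifold (𝓡 k) 1 M] [IsManifold J 1 N] [J.Boundaryless]
  {g : MetricTensor J (N := N)} {ψ : M → N} {p : M}

/-- The tangential half of the Gauss formula: the naturality of the Christoffel symbols of the first
kind under pull-back identifies the right-hand sides of the two Koszul formulas. -/
lemma tangentPart_ambientDeriv (hg : IsSemiRiemannianAt g (ψ p)) (hψ : ContMDiff (𝓡 k) J 2 ψ)
    (v w : EuclideanSpace ℝ (Fin k)) :
    tangentPart k g ψ p (ambientDeriv k g ψ p v w) =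
      diff k J ψ p (christoffelAt (inducedMetric k g ψ) p v w) := by
  set P := writtenInExtChartAt (𝓡 k) J p ψ with hP
  set y := extChartAt (𝓡 k) p p with hy
  have hψd : MDifferentiable (𝓡 k) J ψ := hψ.mdifferentiable (by simp)
  have hPy : P y = extChartAt J (ψ p) (ψ p) := writtenInExtChartAt_extChartAt_self
  have hdiff : diff k J ψ p = fderiv ℝ P y := mfderiv_eq_fderiv_writtenInExtChartAt (hψd p)
  have hGy : coordMetric g (ψ p) (P y) = formAt g (ψ p) := by rw [hPy, coordMetric_self]
  have hcoord := coordMetric_inducedMetric g hψd p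
  rw [tangentPart, christoffelAt, christoffel, coordMetric_self]
  congr 2
  ext z
  change _ = christoffelFirstKind (coordMetric (inducedMetric k g ψ) p) y v w z
  rw [christoffelFirstKind, hcoord.fderiv_eq]
  have hkoszul := christoffelFirstKind_pullback (contDiffAt_writtenInExtChartAt (hψ p))
    (G := coordMetric g (ψ p)) (by rw [← hP, ← hy, hPy]; exact hg.differentiableAt)
    (by rw [hGy]; exact hg.symm) (by rw [hGy]; exact hg.isInvertible) v w z
  rw [hGy] at hkoszul
  refine Eq.trans ?_ hkoszul.symm
  rw [← hP, ← hy, hPy, ← hdiff]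
  rfl

lemma hessian_comp (hg : IsSemiRiemannianAt g (ψ p)) (hψ : ContMDiff (𝓡 k) J 2 ψ) {h : N → ℝ}
    (hh : ContMDiffAt J 𝓘(ℝ, ℝ) 2 h (ψ p)) (v w : EuclideanSpace ℝ (Fin k)) :
    hessian (inducedMetric k g ψ) (h ∘ ψ) p v w =
      hessianAt g h (ψ p) (diff k J ψ p v) (diff k J ψ p w)
        - differential J h (ψ p) (secondFundamentalForm k g ψ p v w) := by
  set P := writtenInExtChartAt (𝓡 k) J p ψ with hP
  set y := extChartAt (𝓡 k) p p with hy
  set η := h ∘ (extChartAt J (ψ p)).symm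
  have hψd : MDifferentiableAt (𝓡 k) J ψ p := (hψ p).mdifferentiableAt (by simp)
  have hPy : P y = extChartAt J (ψ p) (ψ p) := writtenInExtChartAt_extChartAt_self
  have hdiff : diff k J ψ p = fderiv ℝ P y := mfderiv_eq_fderiv_writtenInExtChartAt hψd
  have hdh : differential J h (ψ p) = fderiv ℝ η (P y) := by
    rw [hPy]
    exact mfderiv_eq_fderiv_writtenInExtChartAt (hh.mdifferentiableAt (by simp))
  have hP2 : ContDiffAt ℝ 2 P y := contDiffAt_writtenInExtChartAt (hψ p)
  have hη2 : ContDiffAt ℝ 2 η (P y) := by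
    rw [hPy]
    exact contDiffAt_writtenInExtChartAt hh
  have hcomp : (h ∘ ψ) ∘ (extChartAt (𝓡 k) p).symm =ᶠ[𝓝 y] η ∘ P :=
    (comp_extChartAt_symm_eventuallyEq hψd.continuousAt).fun_comp h
  rw [hessian, hcomp.fderiv.fderiv_eq, hcomp.fderiv_eq, fderiv_fderiv_comp hη2 hP2,
    fderiv_comp y (hη2.differentiableAt (by simp)) (hP2.differentiableAt (by simp)), hessianAt,
    hdh, ← hPy, secondFundamentalForm, normalPart, tangentPart_ambientDeriv hg hψ, ambientDeriv]
  simp only [hdiff, ← hP, ← hy, ContinuousLinearMap.comp_apply, map_neg, map_sub, map_add]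
  ring

lemma laplacian_comp (hg : IsSemiRiemannianAt g (ψ p)) (hψ : ContMDiff (𝓡 k) J 2 ψ) {h : N → ℝ}
    (hh : ContMDiffAt J 𝓘(ℝ, ℝ) 2 h (ψ p)) :
    laplacian (inducedMetric k g ψ) (h ∘ ψ) p =
      metricTrace (formAt (inducedMetric k g ψ) p)
          (fun v w => hessianAt g h (ψ p) (diff k J ψ p v) (diff k J ψ p w))
        - k * differential J h (ψ p) (meanCurvature k g ψ p) := by
  rw [natCast_mul_apply_meanCurvature]
  simp only [laplacian, metricTrace, hessian_comp hg hψ hh, Finset.sum_sub_distrib]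

end SemiRiemannian

section Prod

variable {V : Type*} [NormedAddCommGroup V] [NormedSpace ℝ V] {E H N : Type*}
  [NormedAddCommGroup E] [NormedSpace ℝ E] [TopologicalSpace H] {J : ModelWithCorners ℝ E H}
  [TopologicalSpace N] [ChartedSpace H N]

lemma extChartAt_prod_model_apply (q x : V × N) :
    extChartAt (𝓘(ℝ, V).prod J) q x = (x.1, extChartAt J q.2 x.2) := by
  rw [extChartAt_prod]
  rfl

lemma extChartAt_prod_model_symm_apply (q : V × N) (y : V × E) :
    (extChartAt (𝓘(ℝ, V).prod J) q).symm y = (y.1, (extChartAt J q.2).symm y.2) := by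
  rw [extChartAt_prod]
  rfl

lemma mfderivWithin_extChartAt_prod_model_symm_apply [J.Boundaryless] [IsManifold J 1 N]
    (q : V × N) {y : V × E} (hy : y.2 ∈ (extChartAt J q.2).target) (v : V × E) :
    mfderivWithin 𝓘(ℝ, V × E) (𝓘(ℝ, V).prod J) (extChartAt (𝓘(ℝ, V).prod J) q).symm
        (range (𝓘(ℝ, V).prod J)) y v =
      (v.1, mfderivWithin 𝓘(ℝ, E) J (extChartAt J q.2).symm (range J) y.2 v.2) := by
  have hfst : HasMFDerivAt 𝓘(ℝ, V × E) 𝓘(ℝ, V) (Prod.fst : V × E → V) y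
      (ContinuousLinearMap.fst ℝ V E) := hasFDerivAt_fst.hasMFDerivAt
  have hsnd : HasMFDerivAt 𝓘(ℝ, V × E) 𝓘(ℝ, E) (Prod.snd : V × E → E) y
      (ContinuousLinearMap.snd ℝ V E) := hasFDerivAt_snd.hasMFDerivAt
  have hprod := hfst.prodMk ((hasMFDerivAt_extChartAt_symm q.2 hy).comp y hsnd)
  rw [ModelWithCorners.range_eq_univ, mfderivWithin_univ,
    funext (extChartAt_prod_model_symm_apply (J := J) q)]
  exact congrArg (fun L => L v) hprod.mfderiv

lemma differential_comp_fst {Φ : ℝ → ℝ} {a : ℝ} {q : ℝ × N} (hΦ : HasDerivAt Φ a q.1)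
    (v : ℝ × E) : differential (𝓘(ℝ, ℝ).prod J) (Φ ∘ Prod.fst) q v = a * v.1 := by
  have hcomp := hΦ.hasFDerivAt.hasMFDerivAt.comp q
    (hasMFDerivAt_fst (I := 𝓘(ℝ, ℝ)) (I' := J) (x := q))
  exact (congrArg (fun L => L v) hcomp.mfderiv).trans (mul_comm v.1 a)

end Prod

section Warped

variable {E : Type*} [NormedAddCommGroup E] [NormedSpace ℝ E] {f : ℝ → ℝ}
  {K : E → E →L[ℝ] E →L[ℝ] ℝ} {y : ℝ × E}

/-- The components `-dt² + f(t)² K` of the warped metric, in terms of the components `K` of the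
metric of the fibre. -/
noncomputable def warpedComponents (f : ℝ → ℝ) (K : E → E →L[ℝ] E →L[ℝ] ℝ) (y : ℝ × E) :
    ℝ × E →L[ℝ] ℝ × E →L[ℝ] ℝ :=
  -pullback (ContinuousLinearMap.fst ℝ ℝ E) (ContinuousLinearMap.mul ℝ ℝ)
    + pullback (f y.1 • ContinuousLinearMap.snd ℝ ℝ E) (K y.2)

lemma warpedComponents_apply (f : ℝ → ℝ) (K : E → E →L[ℝ] E →L[ℝ] ℝ) (y v w : ℝ × E) :
    warpedComponents f K y v w = -(v.1 * w.1) + f y.1 ^ 2 * K y.2 v.2 w.2 := by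
  change -(v.1 * w.1) + K y.2 (f y.1 • v.2) (f y.1 • w.2) = _
  rw [map_smul, map_smul, smul_apply, smul_eq_mul, smul_eq_mul]
  ring

lemma differentiableAt_warpedComponents (hf : DifferentiableAt ℝ f y.1)
    (hK : DifferentiableAt ℝ K y.2) : DifferentiableAt ℝ (warpedComponents f K) y := by
  have hfy : DifferentiableAt ℝ (fun z : ℝ × E => f z.1) y := hf.comp y differentiableAt_fst
  have hsnd : DifferentiableAt ℝ (Prod.snd : ℝ × E → E) y := differentiableAt_snd
  have hKy : DifferentiableAt ℝ (fun z : ℝ × E => K z.2) y :=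
    DifferentiableAt.comp (G := E →L[ℝ] E →L[ℝ] ℝ) y hK hsnd
  have hscale : DifferentiableAt ℝ (fun z : ℝ × E => f z.1 • ContinuousLinearMap.snd ℝ ℝ E) y :=
    hfy.smul_const (ContinuousLinearMap.snd ℝ ℝ E)
  exact DifferentiableAt.const_add (𝕜 := ℝ) (E := ℝ × E) (F := ℝ × E →L[ℝ] ℝ × E →L[ℝ] ℝ) (x := y)
    _ (differentiableAt_pullback hscale hKy)

lemma fderiv_warpedComponents_apply (hf : DifferentiableAt ℝ f y.1)
    (hK : DifferentiableAt ℝ K y.2) (u v w : ℝ × E) :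
    fderiv ℝ (warpedComponents f K) y u v w =
      2 * f y.1 * deriv f y.1 * u.1 * K y.2 v.2 w.2
        + f y.1 ^ 2 * fderiv ℝ K y.2 u.2 v.2 w.2 := by
  have hfy : HasFDerivAt (fun z : ℝ × E => f z.1) (deriv f y.1 • ContinuousLinearMap.fst ℝ ℝ E) y :=
    hf.hasDerivAt.comp_hasFDerivAt y hasFDerivAt_fst
  have hKvw : DifferentiableAt ℝ (fun z => K z v.2 w.2) y.2 :=
    (hK.clm_apply (differentiableAt_const _)).clm_apply (differentiableAt_const _)
  have hKy := hKvw.hasFDerivAt.comp y (hasFDerivAt_snd (𝕜 := ℝ) (E := ℝ))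
  have hscalar := ((hfy.pow 2).mul hKy).const_add (-(v.1 * w.1))
  rw [fderiv_apply_apply (differentiableAt_warpedComponents hf hK), fderiv_apply_apply hK]
  simp only [warpedComponents_apply]
  refine (congrArg (fun L => L u) hscalar.fderiv).trans ?_
  simp
  ring

variable {m : ℕ} {F : Type*} [TopologicalSpace F] [ChartedSpace (EuclideanSpace ℝ (Fin m)) F]
  [IsManifold (𝓡 m) ∞ F] {q : ℝ × F}

lemma warpedMetric_apply (f : ℝ → ℝ) (gF : RiemMetric m F) (q : ℝ × F)
    (v w : ℝ × EuclideanSpace ℝ (Fin m)) :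
    formAt (warpedMetric f gF) q v w = -(v.1 * w.1) + f q.1 ^ 2 * formAt gF.inner q.2 v.2 w.2 := by
  simp only [formAt, warpedMetric, mfderiv_fst, mfderiv_snd]
  rfl

lemma warpedMetric_comm (f : ℝ → ℝ) (gF : RiemMetric m F) (q : ℝ × F)
    (v w : ℝ × EuclideanSpace ℝ (Fin m)) :
    formAt (warpedMetric f gF) q v w = formAt (warpedMetric f gF) q w v := by
  have hgF : formAt gF.inner q.2 v.2 w.2 = formAt gF.inner q.2 w.2 v.2 := gF.symm q.2 v.2 w.2
  rw [warpedMetric_apply, warpedMetric_apply, hgF, mul_comm v.1]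

lemma isInvertible_warpedMetric (gF : RiemMetric m F) (hf : f q.1 ≠ 0) :
    (formAt (warpedMetric f gF) q).IsInvertible := by
  refine isInvertible_of_separatingLeft _ fun v hv => ?_
  have hsnd : v.2 = 0 := by
    by_contra hne
    have hspace := hv (0, v.2)
    simp only [warpedMetric_apply, mul_zero, neg_zero, zero_add] at hspace
    have hpos : 0 < formAt gF.inner q.2 v.2 v.2 := gF.pos q.2 v.2 hne
    exact (mul_pos (by positivity) hpos).ne' hspace
  have hfst : v.1 = 0 := by simpa [warpedMetric_apply] using hv (1, 0)
  exact Prod.ext hfst hsnd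

lemma coordMetric_warpedMetric_eventuallyEq (f : ℝ → ℝ) (gF : RiemMetric m F) (q : ℝ × F) :
    coordMetric (warpedMetric f gF) q =ᶠ[𝓝 (extChartAt (𝓘(ℝ, ℝ).prod (𝓡 m)) q q)]
      warpedComponents f (coordMetric gF.inner q.2) := by
  have htarget : ∀ᶠ y in 𝓝 (extChartAt (𝓘(ℝ, ℝ).prod (𝓡 m)) q q),
      y.2 ∈ (extChartAt (𝓡 m) q.2).target := by
    rw [extChartAt_prod_model_apply]
    exact continuousAt_snd.preimage_mem_nhds (extChartAt_target_mem_nhds (I := 𝓡 m) q.2)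
  filter_upwards [htarget] with y hy
  refine ContinuousLinearMap.ext fun v => ContinuousLinearMap.ext fun w => ?_
  refine (congrArg₂ (fun a b : ℝ × EuclideanSpace ℝ (Fin m) =>
    formAt (warpedMetric f gF) ((extChartAt (𝓘(ℝ, ℝ).prod (𝓡 m)) q).symm y) a b)
    (mfderivWithin_extChartAt_prod_model_symm_apply q hy v)
    (mfderivWithin_extChartAt_prod_model_symm_apply q hy w)).trans ?_
  rw [extChartAt_prod_model_symm_apply, warpedComponents_apply]
  exact warpedMetric_apply f gF _ _ _

lemma isSemiRiemannianAt_warpedMetric (gF : RiemMetric m F) (hf : DifferentiableAt ℝ f q.1)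
    (hf0 : f q.1 ≠ 0) : IsSemiRiemannianAt (warpedMetric f gF) q where
  symm := warpedMetric_comm f gF q
  isInvertible := isInvertible_warpedMetric gF hf0
  differentiableAt := by
    refine (coordMetric_warpedMetric_eventuallyEq f gF q).differentiableAt_iff.2 ?_
    rw [extChartAt_prod_model_apply]
    exact differentiableAt_warpedComponents hf (differentiableAt_coordMetric (by simp) gF q.2)

set_option synthInstance.maxHeartbeats 100000 in
-- the group structure on bilinear maps is expensive to synthesize
lemma christoffelAt_warpedMetric_fst (gF : RiemMetric m F) (hf : DifferentiableAt ℝ f q.1)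
    (hf0 : f q.1 ≠ 0) (v w : ℝ × EuclideanSpace ℝ (Fin m)) :
    f q.1 * (christoffelAt (warpedMetric f gF) q v w).1 =
      deriv f q.1 * (formAt (warpedMetric f gF) q v w + v.1 * w.1) := by
  have hself : coordMetric (warpedMetric f gF) q (extChartAt (𝓘(ℝ, ℝ).prod (𝓡 m)) q q) =
    formAt (warpedMetric f gF) q := coordMetric_self _ q
  have hfderiv (a b c : ℝ × EuclideanSpace ℝ (Fin m)) :
      fderiv ℝ (coordMetric (warpedMetric f gF) q)
          (extChartAt (𝓘(ℝ, ℝ).prod (𝓡 m)) q q) a b c =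
        2 * f q.1 * deriv f q.1 * a.1 * formAt gF.inner q.2 b.2 c.2 + f q.1 ^ 2 *
          fderiv ℝ (coordMetric gF.inner q.2) (extChartAt (𝓡 m) q.2 q.2) a.2 b.2 c.2 := by
    rw [(coordMetric_warpedMetric_eventuallyEq f gF q).fderiv_eq, extChartAt_prod_model_apply,
      fderiv_warpedComponents_apply (y := (q.1, extChartAt (𝓡 m) q.2 q.2)) hf
        (differentiableAt_coordMetric (by simp) gF q.2),
      coordMetric_self]
  have hΓ := apply_christoffel (G := coordMetric (warpedMetric f gF) q)
    (y := extChartAt (𝓘(ℝ, ℝ).prod (𝓡 m)) q q)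
    (by rw [hself]; exact isInvertible_warpedMetric gF hf0) v w
  have hΓt := congrArg (fun α => α (1, 0)) hΓ
  simp only [hself, christoffelFirstKind_apply, warpedMetric_apply, hfderiv, map_zero,
    zero_apply] at hΓt
  change _ * (christoffel _ _ v w).1 = _
  rw [warpedMetric_apply]
  linear_combination (-f q.1) * hΓt

lemma hessianAt_warpedMetric_comp_fst (gF : RiemMetric m F) (hf : DifferentiableAt ℝ f q.1)
    (hf0 : f q.1 ≠ 0) {Φ : ℝ → ℝ} (hΦ : ∀ᶠ t in 𝓝 q.1, HasDerivAt Φ (f t) t)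
    (v w : ℝ × EuclideanSpace ℝ (Fin m)) :
    hessianAt (warpedMetric f gF) (Φ ∘ Prod.fst) q v w =
      -deriv f q.1 * formAt (warpedMetric f gF) q v w := by
  have hcoord : (Φ ∘ Prod.fst) ∘ (extChartAt (𝓘(ℝ, ℝ).prod (𝓡 m)) q).symm = Φ ∘ Prod.fst := by
    ext y
    simp only [Function.comp_apply, extChartAt_prod_model_symm_apply]
  have hfderiv : fderiv ℝ (Φ ∘ Prod.fst) =ᶠ[𝓝 (q.1, extChartAt (𝓡 m) q.2 q.2)]
      fun y => f y.1 • ContinuousLinearMap.fst ℝ ℝ (EuclideanSpace ℝ (Fin m)) := by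
    filter_upwards [continuousAt_fst.eventually hΦ] with y hy
    exact (hy.comp_hasFDerivAt y hasFDerivAt_fst).fderiv
  have hfy : HasFDerivAt (fun y : ℝ × EuclideanSpace ℝ (Fin m) => f y.1)
      (deriv f q.1 • ContinuousLinearMap.fst ℝ ℝ (EuclideanSpace ℝ (Fin m)))
      (q.1, extChartAt (𝓡 m) q.2 q.2) :=
    HasDerivAt.comp_hasFDerivAt (h₂ := f) (q.1, extChartAt (𝓡 m) q.2 q.2) hf.hasDerivAt
      hasFDerivAt_fst
  have hf' : HasFDerivAt
      (fun y : ℝ × EuclideanSpace ℝ (Fin m) =>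
        f y.1 • ContinuousLinearMap.fst ℝ ℝ (EuclideanSpace ℝ (Fin m)))
      ((deriv f q.1 • ContinuousLinearMap.fst ℝ ℝ (EuclideanSpace ℝ (Fin m))).smulRight
        (ContinuousLinearMap.fst ℝ ℝ (EuclideanSpace ℝ (Fin m))))
      (q.1, extChartAt (𝓡 m) q.2 q.2) :=
    hfy.smul_const (ContinuousLinearMap.fst ℝ ℝ (EuclideanSpace ℝ (Fin m)))
  have hΓ := christoffelAt_warpedMetric_fst gF hf hf0 v w
  rw [hessianAt, hcoord, extChartAt_prod_model_apply, hfderiv.fderiv_eq, hfderiv.self_of_nhds,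
    hf'.fderiv]
  simp only [ContinuousLinearMap.smulRight_apply, smul_apply, ContinuousLinearMap.coe_fst',
    smul_eq_mul, hΓ]
  ring

end Warped

section Warped

variable {m k : ℕ} {F : Type*} [TopologicalSpace F] [ChartedSpace (EuclideanSpace ℝ (Fin m)) F]
  [IsManifold (𝓡 m) ∞ F] {gF : RiemMetric m F} {f : ℝ → ℝ}
  {M : Type*} [TopologicalSpace M] [ChartedSpace (EuclideanSpace ℝ (Fin k)) M]
  [IsManifold (𝓡 k) 1 M] {ψ : M → ℝ × F} {p : M}

lemma laplacian_comp_time (hψ : ContMDiff (𝓡 k) (𝓘(ℝ, ℝ).prod (𝓡 m)) 2 ψ)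
    (hspace : IsSpacelike k (warpedMetric f gF) ψ) (hf : DifferentiableAt ℝ f (ψ p).1)
    (hf0 : f (ψ p).1 ≠ 0) {Φ : ℝ → ℝ} (hΦ2 : ContDiffAt ℝ 2 Φ (ψ p).1)
    (hΦ : ∀ᶠ t in 𝓝 (ψ p).1, HasDerivAt Φ (f t) t) :
    laplacian (inducedMetric k (warpedMetric f gF) ψ) (fun x => Φ (ψ x).1) p =
      k * f (ψ p).1 * (warpedMetric f gF (ψ p) (meanCurvature k (warpedMetric f gF) ψ p)
        (partialT (ψ p)) - deriv f (ψ p).1 / f (ψ p).1) := by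
  have : IsManifold (𝓡 m) 1 F := .of_le (n := ∞) (by simp)
  have hg := isSemiRiemannianAt_warpedMetric gF hf hf0
  have hh : ContMDiffAt (𝓘(ℝ, ℝ).prod (𝓡 m)) 𝓘(ℝ, ℝ) 2 (Φ ∘ Prod.fst) (ψ p) :=
    hΦ2.contMDiffAt.comp (ψ p) contMDiffAt_fst
  have hsymm (v w : EuclideanSpace ℝ (Fin k)) :
      formAt (inducedMetric k (warpedMetric f gF) ψ) p v w =
        formAt (inducedMetric k (warpedMetric f gF) ψ) p w v := hg.symm _ _
  have htrace : metricTrace (formAt (inducedMetric k (warpedMetric f gF) ψ) p) (fun v w =>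
      hessianAt (warpedMetric f gF) (Φ ∘ Prod.fst) (ψ p)
        (diff k (𝓘(ℝ, ℝ).prod (𝓡 m)) ψ p v) (diff k (𝓘(ℝ, ℝ).prod (𝓡 m)) ψ p w)) =
      -deriv f (ψ p).1 * k := by
    rw [← metricTrace_self hsymm (hspace.isInvertible_inducedMetric p)]
    simp only [metricTrace, hessianAt_warpedMetric_comp_fst gF hf hf0 hΦ, ← Finset.mul_sum]
    rfl
  have hHt : warpedMetric f gF (ψ p) (meanCurvature k (warpedMetric f gF) ψ p) (partialT (ψ p)) =
      -(meanCurvature k (warpedMetric f gF) ψ p).1 := by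
    refine (warpedMetric_apply f gF (ψ p) _ _).trans ?_
    simp [partialT]
  have hdΦ : differential (𝓘(ℝ, ℝ).prod (𝓡 m)) (Φ ∘ Prod.fst) (ψ p)
      (meanCurvature k (warpedMetric f gF) ψ p) =
        f (ψ p).1 * (meanCurvature k (warpedMetric f gF) ψ p).1 :=
    differential_comp_fst hΦ.self_of_nhds _
  refine (laplacian_comp hg hψ hh).trans ?_
  rw [htrace, hdΦ, hHt]
  field_simp
  ring

end Warped

section Laplacian

variable {k : ℕ} {M : Type*} [TopologicalSpace M] [ChartedSpace (EuclideanSpace ℝ (Fin k)) M]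
  {g : MetricTensor (𝓡 k) (N := M)}

lemma hessian_neg (g : MetricTensor (𝓡 k) (N := M)) (u : M → ℝ) (p : M)
    (v w : EuclideanSpace ℝ (Fin k)) : hessian g (-u) p v w = -hessian g u p v w := by
  have hfderiv : fderiv ℝ (-(u ∘ (extChartAt (𝓡 k) p).symm)) =
      -fderiv ℝ (u ∘ (extChartAt (𝓡 k) p).symm) := funext fun _ => fderiv_neg
  rw [hessian, hessian, Pi.neg_comp, hfderiv, fderiv_neg]
  simp only [neg_apply, Pi.neg_apply]
  ring

lemma laplacian_neg (g : MetricTensor (𝓡 k) (N := M)) (u : M → ℝ) (p : M) :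
    laplacian g (-u) p = -laplacian g u p := by
  simp only [laplacian, metricTrace, hessian_neg, Finset.sum_neg_distrib]

lemma IsParabolic.eq_const_of_subharmonic (hg : IsParabolic g) {u : M → ℝ}
    (hu : ContMDiff (𝓡 k) 𝓘(ℝ, ℝ) ∞ u) (hsub : ∀ p, 0 ≤ laplacian g u p)
    (hbdd : BddAbove (range u)) : ∃ c, ∀ p, u p = c := by
  have hsuper (p : M) : laplacian g (-u) p ≤ 0 := by
    rw [laplacian_neg]
    exact neg_nonpos.2 (hsub p)
  have hbdd_neg : BddBelow (range (-u)) := by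
    obtain ⟨b, hb⟩ := hbdd
    exact ⟨-b, forall_mem_range.2 fun p => neg_le_neg (hb (mem_range_self p))⟩
  obtain ⟨c, hc⟩ := hg (-u) hu.neg hsuper hbdd_neg
  exact ⟨-c, fun p => neg_eq_iff_eq_neg.1 (hc p)⟩

end Laplacian

section Primitive

variable {f Φ : ℝ → ℝ} {I : Set ℝ}

lemma exists_primitive_of_continuousOn (hI : IsOpen I) (hI' : I.OrdConnected)
    (hf : ContinuousOn f I) : ∃ Φ : ℝ → ℝ, ∀ t ∈ I, HasDerivAt Φ (f t) t := by
  rcases I.eq_empty_or_nonempty with rfl | ⟨c, hc⟩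
  · exact ⟨0, fun t ht => ht.elim⟩
  · exact ⟨fun t => ∫ s in c..t, f s, fun t ht =>
      intervalIntegral.integral_hasDerivAt_right
        (hf.mono (hI'.uIcc_subset hc ht)).intervalIntegrable
        (hf.stronglyMeasurableAtFilter hI t ht) (hf.continuousAt (hI.mem_nhds ht))⟩

lemma contDiffOn_infty_of_hasDerivAt (hI : IsOpen I) (hf : ContDiffOn ℝ ∞ f I)
    (hΦ : ∀ t ∈ I, HasDerivAt Φ (f t) t) : ContDiffOn ℝ ∞ Φ I :=
  (contDiffOn_infty_iff_deriv_of_isOpen hI).2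
    ⟨fun t ht => (hΦ t ht).differentiableAt.differentiableWithinAt,
      hf.congr fun t ht => (hΦ t ht).deriv⟩

lemma strictMonoOn_of_hasDerivAt_pos (hI : I.OrdConnected) (hΦ : ∀ t ∈ I, HasDerivAt Φ (f t) t)
    (hf : ∀ t ∈ I, 0 < f t) : StrictMonoOn Φ I :=
  strictMonoOn_of_hasDerivWithinAt_pos hI.convex
    (fun t ht => (hΦ t ht).continuousAt.continuousWithinAt)
    (fun t ht => (hΦ t (interior_subset ht)).hasDerivWithinAt)
    (fun t ht => hf t (interior_subset ht))

end Primitive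

end GRW

theorem theorem4p8_general {m k : ℕ}
    {F : Type*} [TopologicalSpace F] [ChartedSpace (EuclideanSpace ℝ (Fin m)) F]
    [IsManifold (𝓡 m) ∞ F] (gF : GRW.RiemMetric m F)
    (I : Set ℝ) (hI : IsOpen I) (hI' : I.OrdConnected)
    (f : ℝ → ℝ) (hf : ContDiffOn ℝ ∞ f I) (hfpos : ∀ t ∈ I, 0 < f t)
    {M : Type*} [TopologicalSpace M] [ChartedSpace (EuclideanSpace ℝ (Fin k)) M]
    [IsManifold (𝓡 k) ∞ M] [Nonempty M]
    (ψ : M → ℝ × F) (hψ : ContMDiff (𝓡 k) (𝓘(ℝ, ℝ).prod (𝓡 m)) ∞ ψ)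
    (hψI : ∀ p, (ψ p).1 ∈ I)
    (hspace : GRW.IsSpacelike k (GRW.warpedMetric f gF) ψ)
    (hpar : GRW.IsParabolic (GRW.inducedMetric k (GRW.warpedMetric f gF) ψ))
    (hH :
      (∃ c ∈ I, ∀ p, c ≤ (ψ p).1 ∧
        GRW.warpedMetric f gF (ψ p) (GRW.meanCurvature k (GRW.warpedMetric f gF) ψ p)
          (GRW.partialT (ψ p)) ≤ deriv f (ψ p).1 / f (ψ p).1) ∨
      (∃ d ∈ I, ∀ p, (ψ p).1 ≤ d ∧ deriv f (ψ p).1 / f (ψ p).1 ≤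
        GRW.warpedMetric f gF (ψ p) (GRW.meanCurvature k (GRW.warpedMetric f gF) ψ p)
          (GRW.partialT (ψ p)))) :
    ∃ t₀ ∈ I, range ψ ⊆ GRW.slice F t₀ := by
  have : IsManifold (𝓡 k) 1 M := .of_le (n := ∞) (by simp)
  obtain ⟨Φ, hΦ⟩ := GRW.exists_primitive_of_continuousOn hI hI' hf.continuousOn
  have hmono : StrictMonoOn Φ I := GRW.strictMonoOn_of_hasDerivAt_pos hI' hΦ hfpos
  have hsmooth (p : M) : ContDiffAt ℝ ∞ Φ (ψ p).1 :=
    (GRW.contDiffOn_infty_of_hasDerivAt hI hf hΦ).contDiffAt (hI.mem_nhds (hψI p))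
  have hu : ContMDiff (𝓡 k) 𝓘(ℝ, ℝ) ∞ (fun p => Φ (ψ p).1) := fun p =>
    (hsmooth p).contMDiffAt.comp p (contMDiff_fst.comp hψ p)
  have hlap (p : M) := GRW.laplacian_comp_time (p := p) (hψ.of_le ENat.LEInfty.out) hspace
    ((hf.contDiffAt (hI.mem_nhds (hψI p))).differentiableAt (by simp)) (hfpos _ (hψI p)).ne'
    ((hsmooth p).of_le ENat.LEInfty.out) (Filter.eventually_of_mem (hI.mem_nhds (hψI p)) hΦ)
  have hkf (p : M) : 0 ≤ k * f (ψ p).1 := mul_nonneg k.cast_nonneg (hfpos _ (hψI p)).le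
  have hconst : ∃ a, ∀ p, Φ (ψ p).1 = a := by
    rcases hH with ⟨c, hc, hH⟩ | ⟨d, hd, hH⟩
    · refine hpar _ hu (fun p => ?_)
        ⟨Φ c, forall_mem_range.2 fun p => hmono.monotoneOn hc (hψI p) (hH p).1⟩
      rw [hlap]
      exact mul_nonpos_of_nonneg_of_nonpos (hkf p) (sub_nonpos.2 (hH p).2)
    · refine hpar.eq_const_of_subharmonic hu (fun p => ?_)
        ⟨Φ d, forall_mem_range.2 fun p => hmono.monotoneOn (hψI p) hd (hH p).1⟩
      rw [hlap]
      exact mul_nonneg (hkf p) (sub_nonneg.2 (hH p).2)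
  obtain ⟨a, ha⟩ := hconst
  obtain ⟨p₀⟩ : Nonempty M := inferInstance
  refine ⟨(ψ p₀).1, hψI p₀, ?_⟩
  rintro _ ⟨p, rfl⟩
  exact ⟨hmono.injOn (hψI p) (hψI p₀) ((ha p).trans (ha p₀).symm), mem_univ _⟩

open Set in
open scoped Manifold ContDiff in
/-- Parabolic spacelike submanifolds `ψ(M)` of a GRW spacetime `I ×_f F` that lie in a slab and
satisfy one of the two mean curvature bounds are contained in a spacelike slice. -/
theorem theorem4p8 {m k : ℕ} (hm : 2 ≤ m)
    {F : Type*} [TopologicalSpace F] [ChartedSpace (EuclideanSpace ℝ (Fin m)) F]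
    [IsManifold (𝓡 m) ∞ F] [ConnectedSpace F] (gF : GRW.RiemMetric m F)
    (I : Set ℝ) (hI : IsOpen I) (hI' : I.OrdConnected)
    (f : ℝ → ℝ) (hf : ContDiffOn ℝ ∞ f I) (hfpos : ∀ t ∈ I, 0 < f t)
    {M : Type*} [TopologicalSpace M] [ChartedSpace (EuclideanSpace ℝ (Fin k)) M]
    [IsManifold (𝓡 k) ∞ M] [ConnectedSpace M]
    (ψ : M → ℝ × F) (hψ : ContMDiff (𝓡 k) (𝓘(ℝ, ℝ).prod (𝓡 m)) ∞ ψ)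
    (hψI : ∀ p, (ψ p).1 ∈ I)
    (hspace : GRW.IsSpacelike k (GRW.warpedMetric f gF) ψ)
    (hpar : GRW.IsParabolic (GRW.inducedMetric k (GRW.warpedMetric f gF) ψ))
    (hslab : GRW.InSlab I (range ψ))
    (hH :
      (∀ p, GRW.warpedMetric f gF (ψ p) (GRW.meanCurvature k (GRW.warpedMetric f gF) ψ p)
          (GRW.partialT (ψ p)) ≤ deriv f (ψ p).1 / f (ψ p).1) ∨
      (∀ p, deriv f (ψ p).1 / f (ψ p).1 ≤
        GRW.warpedMetric f gF (ψ p) (GRW.meanCurvature k (GRW.warpedMetric f gF) ψ p)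
          (GRW.partialT (ψ p)))) :
    ∃ t₀ ∈ I, range ψ ⊆ GRW.slice F t₀ := by
  obtain ⟨c, hc, d, hd, hcd⟩ := hslab
  have hτ (p : M) : (ψ p).1 ∈ Icc c d := (hcd (mem_range_self p)).1
  exact theorem4p8_general gF I hI hI' f hf hfpos ψ hψ hψI hspace hpar
    (hH.imp (fun h => ⟨c, hc, fun p => ⟨(hτ p).1, h p⟩⟩)
      (fun h => ⟨d, hd, fun p => ⟨(hτ p).2, h p⟩⟩))
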